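/- Let $n\ge 0$ and let $G=q(n+1)$ be the Lie superalgebra of complex matrices $\begin{pmatrix}A&B\\B&A\end{pmatrix}$ with $A,B\in gl(n+1)$ (rows and columns of $A$ and $B$ numbered $0,\dots,n$; the matrices with $B=0$ are even, those with $A=0$ odd), with the bracket $[\![x,y]\!]=xy-(-1)^{\sigma\theta}yx$ for $x$ of degree $\sigma$ and $y$ of degree $\theta$. Let $e_{ij}^{\bar 0}$ and $e_{ij}^{\bar 1}$ be its basis elements with $(A,B)=(E_{ij},0)$ and $(A,B)=(0,E_{ij})$. For $1\le j\le n$ put $b_j^+=e_{j0}^{\bar 0}$, $b_j^-=e_{0j}^{\bar 0}$, $f_j^+=e_{j0}^{\bar 1}$, $f_j^-=e_{0j}^{\bar 1}$; let $P$ be the span of all $b_j^-,f_j^-$ and $\tilde G=\mathrm{span}\{e_{00}^\sigma\}\oplus\mathrm{span}\{e_{ij}^\sigma: 1\le i,j\le n\}$. Let $p\in\mathbb C$ and let $\sqrt p$ be a fixed square root of $p$. Let $\mathbb Cv_0$ be the one-dimensional $(\tilde G+P)$-module with $e_{00}^{\bar 0}v_0=p\,v_0$, $e_{00}^{\bar 1}v_0=\sqrt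 p\,v_0$, $e_{ij}^\sigma v_0=0$ for $1\le i,j\le n$, and $Pv_0=0$, and let $\bar V_p=U(G)\otimes_{\tilde G+P}\mathbb Cv_0$ be the induced $G$-module. For ${\bf k}=(k_1,\dots,k_n)$ with integers $k_i\ge 0$ and ${\bf l}=(l_1,\dots,l_n)$ with $l_i\in\{0,1\}$ put $$|p;{\bf k},{\bf l}\rangle=(b_1^+)^{k_1}(f_1^+)^{l_1}\cdots(b_n^+)^{k_n}(f_n^+)^{l_n}v_0,$$ $$X(p;{\bf k},{\bf l})=(-1)^{l_1+\cdots+l_n}\sqrt p\,|p;{\bf k},{\bf l}\rangle-\sum_{i=1}^n(-1)^{l_1+\cdots+l_i}l_i\,|k_i+1,l_i-1\rangle-\sum_{i=1}^n(-1)^{l_1+\cdots+l_i}\delta_{l_i,0}\,k_i\,|k_i-1,l_i+1\rangle,$$ where inside $|\cdot\rangle$ and $X(p;\cdot)$ only the changed labels are written, and terms with coefficient zero are omitted. Then, for $1\le j\le n$, $$b_j^+|p;{\bf k},{\bf l}\rangle=|k_j+1\rangle,\qquad f_j^+|p;{\bf k},{\bf l}\rangle=\delta_{l_j,0}(-1)^{l_1+\cdots+l_{j-1}}|l_j+1\rangle,$$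 $$b_j^-|p;{\bf k},{\bf l}\rangle=k_j\Bigl(p+1-\sum_{i=1}^n(k_i+l_i)\Bigr)|k_j-1\rangle+(-1)^{l_1+\cdots+l_{j-1}}l_j\,X(p;l_j-1),$$ $$f_j^-|p;{\bf k},{\bf l}\rangle=(-1)^{l_1+\cdots+l_{j-1}}l_j\Bigl(p+1-\sum_{i=1}^n(k_i+l_i)\Bigr)|l_j-1\rangle+k_j\,X(p;k_j-1),$$ $$b_j^+X(p;{\bf k},{\bf l})=X(p;k_j+1)+(-1)^{l_1+\cdots+l_j}\delta_{l_j,0}\,|l_j+1\rangle,$$ $$f_j^+X(p;{\bf k},{\bf l})=-\delta_{l_j,0}(-1)^{l_1+\cdots+l_{j-1}}X(p;l_j+1)+|k_j+1\rangle,$$ $$b_j^-X(p;{\bf k},{\bf l})=k_j\Bigl(p-\sum_{i=1}^n(k_i+l_i)\Bigr)X(p;k_j-1),$$ $$f_j^-X(p;{\bf k},{\bf l})=(-1)^{l_1+\cdots+l_j}\,l_j\Bigl(p-\sum_{i=1}^n(k_i+l_i)\Bigr)X(p;l_j-1).$$ In particular, if $\sum_{i=1}^n(k_i+l_i)=p$,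 then $x\,X(p;{\bf k},{\bf l})=0$ for every $x\in P$. -/

import Mathlib

open scoped TensorProduct

namespace QFock

noncomputable section

/-- The space of all complex matrices of order `2(n+1)` of block form `(A B; B A)`. It is closed
under the matrix product; as a Lie superalgebra it is `q(n+1)`. Rows and columns inside a block
are indexed by `0, 1, …, n`. -/
def q (n : ℕ) :
    Subalgebra ℂ (Matrix (Fin (n + 1) ⊕ Fin (n + 1)) (Fin (n + 1) ⊕ Fin (n + 1)) ℂ) where
  carrier := {M | ∃ A B, M = Matrix.fromBlocks A B B A}
  mul_mem' := by
    rintro _ _ ⟨A, B, rfl⟩ ⟨C, D, rfl⟩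
    refine ⟨A * C + B * D, A * D + B * C, ?_⟩
    rw [Matrix.fromBlocks_multiply, add_comm (B * C) (A * D), add_comm (B * D) (A * C)]
  add_mem' := by
    rintro _ _ ⟨A, B, rfl⟩ ⟨C, D, rfl⟩
    exact ⟨A + C, B + D, Matrix.fromBlocks_add _ _ _ _ _ _ _ _⟩
  algebraMap_mem' := by
    intro r
    refine ⟨algebraMap ℂ _ r, 0, ?_⟩
    simp only [Algebra.algebraMap_eq_smul_one, ← Matrix.fromBlocks_one, Matrix.fromBlocks_smul,
      smul_zero]

/-- The element `(A B; B A)` of `q(n+1)`. -/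
def ofBlocks {n : ℕ} (A B : Matrix (Fin (n + 1)) (Fin (n + 1)) ℂ) : q n :=
  ⟨Matrix.fromBlocks A B B A, A, B, rfl⟩

/-- The homogeneous elements of `q(n+1)`: those with `B = 0` are even, those with `A = 0` odd. -/
def IsHomogeneous {n : ℕ} (σ : ZMod 2) (x : q n) : Prop :=
  (σ = 0 ∧ ∃ A, x = ofBlocks A 0) ∨ (σ = 1 ∧ ∃ B, x = ofBlocks 0 B)

/-- The Lie superbracket of elements `x` of degree `σ` and `y` of degree `θ`. -/
def superBracket {n : ℕ} (σ θ : ZMod 2) (x y : q n) : q n :=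
  x * y - (-1 : ℂ) ^ (σ.val * θ.val) • (y * x)

/-- The basis elements `e_{ij}^σ` of `q(n+1)`. -/
def e {n : ℕ} (i j : Fin (n + 1)) (σ : ZMod 2) : q n :=
  if σ = 0 then ofBlocks (Matrix.single i j 1) 0 else ofBlocks 0 (Matrix.single i j 1)

/-- The relations `x y - (-1)^{σθ} y x = ⟦x, y⟧` of the universal enveloping algebra. -/
inductive EnvelopingRel (n : ℕ) : TensorAlgebra ℂ (q n) → TensorAlgebra ℂ (q n) → Prop
  | bracket (σ θ : ZMod 2) (x y : q n) (hx : IsHomogeneous σ x) (hy : IsHomogeneous θ y) :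
      EnvelopingRel n
        (TensorAlgebra.ι ℂ x * TensorAlgebra.ι ℂ y
          - (-1 : ℂ) ^ (σ.val * θ.val) • (TensorAlgebra.ι ℂ y * TensorAlgebra.ι ℂ x))
        (TensorAlgebra.ι ℂ (superBracket σ θ x y))

/-- The universal enveloping algebra `U(G)` of the Lie superalgebra `G = q(n+1)`. -/
def U (n : ℕ) : Type := RingQuot (EnvelopingRel n)

instance (n : ℕ) : Ring (U n) := inferInstanceAs (Ring (RingQuot (EnvelopingRel n)))

instance (n : ℕ) : Algebra ℂ (U n) := inferInstanceAs (Algebra ℂ (RingQuot (EnvelopingRel n)))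

/-- The canonical map `G → U(G)`. -/
def ι (n : ℕ) : q n →ₗ[ℂ] U n :=
  (RingQuot.mkAlgHom ℂ (EnvelopingRel n)).toLinearMap ∘ₗ TensorAlgebra.ι ℂ

/-- The subalgebra `q(1) = span {e_{00}^σ}` of `q(n+1)`. -/
def qOne (n : ℕ) : Submodule ℂ (q n) :=
  Submodule.span ℂ {x | ∃ σ, x = e 0 0 σ}

/-- The subalgebra `q(n) = span {e_{ij}^σ | i, j = 1, …, n}` of `q(n+1)`. -/
def qSub (n : ℕ) : Submodule ℂ (q n) :=
  Submodule.span ℂ {x | ∃ (i j : Fin n) (σ : ZMod 2), x = e i.succ j.succ σ}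

/-- The subspace `P = span {e_{0i}^σ | i = 1, …, n}`, spanned by the annihilation operators. -/
def P (n : ℕ) : Submodule ℂ (q n) :=
  Submodule.span ℂ {x | ∃ (i : Fin n) (σ : ZMod 2), x = e 0 i.succ σ}

/-- The subalgebra `q(1) ⊕ q(n) + P` of `q(n+1)`. -/
def parabolic (n : ℕ) : Submodule ℂ (q n) := qOne n ⊔ qSub n ⊔ P n

/-- The scalar by which `x ∈ q(1) ⊕ q(n) + P` acts on the one-dimensional module `ℂ v₀`:
`e_{00}^0` acts by `p = s ^ 2`, `e_{00}^1` by the square root `s` of `p`, and `q(n)` and `P`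
act by `0`. -/
def vacuumScalar {n : ℕ} (s : ℂ) (x : q n) : ℂ :=
  s ^ 2 * x.1 (Sum.inl 0) (Sum.inl 0) + s * x.1 (Sum.inl 0) (Sum.inr 0)

/-- The relations `u h ⊗ c = u ⊗ h c`, for `h` in `q(1) ⊕ q(n) + P`, that turn the tensor product
of `U(G)` and `ℂ v₀` over `ℂ` into the tensor product over `q(1) ⊕ q(n) + P`. -/
def balanced (n : ℕ) (s : ℂ) : Submodule (U n) (U n ⊗[ℂ] ℂ) :=
  Submodule.span (U n)
    {z | ∃ (u : U n) (h : q n) (c : ℂ), h ∈ parabolic n ∧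
      z = (u * ι n h) ⊗ₜ[ℂ] c - u ⊗ₜ[ℂ] (vacuumScalar s h * c)}

/-- The induced module `V̄_p`, where `p = s ^ 2` and `s` is the chosen square root of `p`. -/
abbrev VBar (n : ℕ) (s : ℂ) : Type := (U n ⊗[ℂ] ℂ) ⧸ balanced n s

/-- The vacuum vector `v₀`. -/
def vacuum (n : ℕ) (s : ℂ) : VBar n s := (balanced n s).mkQ ((1 : U n) ⊗ₜ[ℂ] (1 : ℂ))

/-- The even creation operators `b_j^+ = e_{j0}^0`, for `j = 1, …, n`. -/
def bPlus {n : ℕ} (j : Fin n) : U n := ι n (e j.succ 0 0)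

/-- The even annihilation operators `b_j^- = e_{0j}^0`. -/
def bMinus {n : ℕ} (j : Fin n) : U n := ι n (e 0 j.succ 0)

/-- The odd creation operators `f_j^+ = e_{j0}^1`. -/
def fPlus {n : ℕ} (j : Fin n) : U n := ι n (e j.succ 0 1)

/-- The odd annihilation operators `f_j^- = e_{0j}^1`. -/
def fMinus {n : ℕ} (j : Fin n) : U n := ι n (e 0 j.succ 1)

/-- The vector `|p; k, l⟩ = (b_1^+)^{k_1} (f_1^+)^{l_1} ⋯ (b_n^+)^{k_n} (f_n^+)^{l_n} v₀`. -/
def ket {n : ℕ} (s : ℂ) (k l : Fin n → ℕ) : VBar n s :=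
  (List.ofFn fun i => bPlus i ^ k i * fPlus i ^ l i).prod • vacuum n s

/-- The sign `(-1)^{l_1 + ⋯ + l_{j-1}}`. -/
def signBelow {n : ℕ} (l : Fin n → ℕ) (j : Fin n) : ℂ := (-1) ^ (∑ i ∈ Finset.Iio j, l i)

/-- The sign `(-1)^{l_1 + ⋯ + l_j}`. -/
def signUpTo {n : ℕ} (l : Fin n → ℕ) (j : Fin n) : ℂ := (-1) ^ (∑ i ∈ Finset.Iic j, l i)

/-- The vector `a` with its entry at the place `j` replaced by `c`. -/
abbrev upd {n : ℕ} (a : Fin n → ℕ) (j : Fin n) (c : ℕ) : Fin n → ℕ := Function.update a j c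

/-- The vector `X(p; k, l)`. The truncated differences occur only with coefficient zero. -/
def X {n : ℕ} (s : ℂ) (k l : Fin n → ℕ) : VBar n s :=
  ((-1 : ℂ) ^ (∑ i, l i) * s) • ket s k l
    - ∑ i, (signUpTo l i * l i) • ket s (upd k i (k i + 1)) (upd l i (l i - 1))
    - ∑ i, (signUpTo l i * (if l i = 0 then 1 else 0) * k i) •
        ket s (upd k i (k i - 1)) (upd l i (l i + 1))

end

end QFock

namespace QFock

noncomputable section

variable {n : ℕ}

/-! Write E for the odd element `e 0 0 1`. The creation operators supercommute, so each |p; k, l⟩ is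
a monomial in even variables b_i^+ and odd variables f_i^+ of square zero, applied to the vacuum.
Moving a generator past these variables is a Leibniz rule, so induction on the labels shows that
q(n) acts by first-order differential operators (`e_even_smul_ket`, `e_odd_smul_ket`), e_{00}^0 by p
minus the level, and E by a parity sign times s plus an odd derivation (`e_zero_odd_smul_ket`).
Hence X = E|p; k, l⟩ (`X_eq`), which explains the shape of X.

Let D and O be the even and odd derivatives at j of |p; k, l⟩ and c = p + 1 - level. Induction also
gives b_j^-|p; k, l⟩ = cD + E O and f_j^-|p; k, l⟩ = cO + E D (`annihilation_smul_ket`). The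
formulas on X follow by commuting operators past E, because E² = e_{00}^0 acts on D and O by c.

The derivatives are defined on labels, not on vectors, so linear independence of the monomials is
never needed. -/

/-! ### Supercommutators of matrix units in U(G). -/

theorem isHomogeneous_e (i j : Fin (n + 1)) (σ : ZMod 2) : IsHomogeneous σ (e i j σ) := by
  fin_cases σ
  · exact Or.inl ⟨rfl, _, rfl⟩
  · exact Or.inr ⟨rfl, _, rfl⟩

theorem ofBlocks_mul (A B C D : Matrix (Fin (n + 1)) (Fin (n + 1)) ℂ) :
    ofBlocks A B * ofBlocks C D = ofBlocks (A * C + B * D) (A * D + B * C) := by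
  apply Subtype.ext
  change Matrix.fromBlocks A B B A * Matrix.fromBlocks C D D C = Matrix.fromBlocks _ _ _ _
  rw [Matrix.fromBlocks_multiply, add_comm (B * C) (A * D), add_comm (B * D) (A * C)]

theorem ofBlocks_zero : ofBlocks (0 : Matrix (Fin (n + 1)) (Fin (n + 1)) ℂ) 0 = 0 :=
  Subtype.ext Matrix.fromBlocks_zero

theorem e_mul_e (a b c d : Fin (n + 1)) (σ θ : ZMod 2) :
    e a b σ * e c d θ = if b = c then e a d (σ + θ) else 0 := by
  have h : (1 + 1 : ZMod 2) = 0 := rfl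
  have h2 : ∀ τ : ZMod 2, τ = 0 ∨ τ = 1 := by decide
  obtain rfl | rfl := h2 σ <;> obtain rfl | rfl := h2 θ <;> by_cases hbc : b = c <;>
    simp [e, ofBlocks_mul, hbc, h, ofBlocks_zero]

theorem ι_mul_sub (σ θ : ZMod 2) (x y : q n) (hx : IsHomogeneous σ x) (hy : IsHomogeneous θ y) :
    ι n x * ι n y - (-1 : ℂ) ^ (σ.val * θ.val) • (ι n y * ι n x) =
      ι n (superBracket σ θ x y) := by
  have h := RingQuot.mkAlgHom_rel ℂ (EnvelopingRel.bracket σ θ x y hx hy)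
  simp only [map_sub, map_mul, map_smul] at h
  exact h

/-- The supercommutation relations of the basis elements in the enveloping algebra. -/
theorem ι_e_mul_ι_e (a b c d : Fin (n + 1)) (σ θ : ZMod 2) :
    ι n (e a b σ) * ι n (e c d θ) =
      (-1 : ℂ) ^ (σ.val * θ.val) • (ι n (e c d θ) * ι n (e a b σ))
        + (if b = c then ι n (e a d (σ + θ)) else 0)
        - (-1 : ℂ) ^ (σ.val * θ.val) • (if d = a then ι n (e c b (σ + θ)) else 0) := by
  have h := ι_mul_sub σ θ _ _ (isHomogeneous_e a b σ) (isHomogeneous_e c d θ)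
  rw [superBracket, e_mul_e, e_mul_e, map_sub, map_smul, add_comm θ σ] at h
  rw [sub_eq_iff_eq_add] at h
  rw [h]
  simp only [apply_ite (ι n), map_zero]
  abel

section Module

variable {V : Type*} [AddCommGroup V] [Module ℂ V] [Module (U n) V] [IsScalarTower ℂ (U n) V]

theorem ι_e_smul_ι_e_smul (a b c d : Fin (n + 1)) (σ θ : ZMod 2) (v : V) :
    ι n (e a b σ) • ι n (e c d θ) • v =
      (-1 : ℂ) ^ (σ.val * θ.val) • ι n (e c d θ) • ι n (e a b σ) • v
        + (if b = c then ι n (e a d (σ + θ)) • v else 0)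
        - (-1 : ℂ) ^ (σ.val * θ.val) • (if d = a then ι n (e c b (σ + θ)) • v else 0) := by
  rw [smul_smul, ι_e_mul_ι_e, sub_smul, add_smul, smul_assoc, mul_smul, smul_assoc]
  split_ifs <;> simp only [zero_smul]

end Module

/-! ### The action on the vacuum. -/

theorem e_zero_zero_mem_parabolic (σ : ZMod 2) : e 0 0 σ ∈ parabolic n :=
  Submodule.mem_sup_left (Submodule.mem_sup_left (Submodule.subset_span ⟨σ, rfl⟩))

theorem e_succ_succ_mem_parabolic (i j : Fin n) (σ : ZMod 2) :
    e i.succ j.succ σ ∈ parabolic n :=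
  Submodule.mem_sup_left (Submodule.mem_sup_right (Submodule.subset_span ⟨i, j, σ, rfl⟩))

theorem e_zero_succ_mem_parabolic (j : Fin n) (σ : ZMod 2) : e 0 j.succ σ ∈ parabolic n :=
  Submodule.mem_sup_right (Submodule.subset_span ⟨j, σ, rfl⟩)

/-- This is the balancing relation with u = 1 and c = 1. -/
theorem ι_smul_vacuum (s : ℂ) {h : q n} (hh : h ∈ parabolic n) :
    ι n h • vacuum n s = vacuumScalar s h • vacuum n s := by
  rw [vacuum, ← map_smul, Submodule.mkQ_apply, Submodule.mkQ_apply, ← Submodule.Quotient.mk_smul,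
    Submodule.Quotient.eq]
  refine Submodule.subset_span ⟨1, h, 1, hh, ?_⟩
  rw [TensorProduct.smul_tmul', TensorProduct.smul_tmul', smul_eq_mul, TensorProduct.smul_tmul]
  simp

theorem vacuumScalar_e (s : ℂ) (i j : Fin (n + 1)) (σ : ZMod 2) :
    vacuumScalar s (e i j σ) =
      if i = 0 ∧ j = 0 then (if σ = 0 then s ^ 2 else s) else 0 := by
  by_cases hσ : σ = 0 <;> simp [vacuumScalar, e, ofBlocks, hσ, Matrix.single_apply]

theorem e_zero_zero_even_smul_vacuum (s : ℂ) :
    ι n (e 0 0 0) • vacuum n s = s ^ 2 • vacuum n s := by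
  rw [ι_smul_vacuum s (e_zero_zero_mem_parabolic 0), vacuumScalar_e]; simp

theorem e_zero_zero_odd_smul_vacuum (s : ℂ) :
    ι n (e 0 0 1) • vacuum n s = s • vacuum n s := by
  rw [ι_smul_vacuum s (e_zero_zero_mem_parabolic 1), vacuumScalar_e]; simp

theorem e_succ_succ_smul_vacuum (s : ℂ) (i j : Fin n) (σ : ZMod 2) :
    ι n (e i.succ j.succ σ) • vacuum n s = 0 := by
  rw [ι_smul_vacuum s (e_succ_succ_mem_parabolic i j σ), vacuumScalar_e]; simp

theorem e_zero_succ_smul_vacuum (s : ℂ) (j : Fin n) (σ : ZMod 2) :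
    ι n (e 0 j.succ σ) • vacuum n s = 0 := by
  rw [ι_smul_vacuum s (e_zero_succ_mem_parabolic j σ), vacuumScalar_e]; simp

/-! ### Creation operators and their action on monomials. -/

theorem bPlus_mul_bPlus (i j : Fin n) : bPlus i * bPlus j = bPlus j * bPlus i := by
  simp [bPlus, ι_e_mul_ι_e i.succ 0 j.succ 0, (Fin.succ_ne_zero _).symm]

theorem fPlus_mul_bPlus (i j : Fin n) : fPlus i * bPlus j = bPlus j * fPlus i := by
  simp [bPlus, fPlus, ι_e_mul_ι_e i.succ 0 j.succ 0, (Fin.succ_ne_zero _).symm]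

theorem fPlus_mul_fPlus (i j : Fin n) : fPlus i * fPlus j = -(fPlus j * fPlus i) := by
  simp [fPlus, ι_e_mul_ι_e i.succ 0 j.succ 0 1 1, ZMod.val_one, (Fin.succ_ne_zero _).symm]

theorem fPlus_mul_self (i : Fin n) : fPlus i * fPlus i = 0 := by
  have h := fPlus_mul_fPlus i i
  rw [eq_neg_iff_add_eq_zero, ← two_smul ℂ] at h
  exact (smul_eq_zero.mp h).resolve_left two_ne_zero

/-- An element that commutes up to scalars with the factors to the left of the place `j` can be
moved there. -/
theorem mul_prod_ofFn {A : Type*} [Ring A] [Algebra ℂ A] (x : A) :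
    ∀ {m : ℕ} (g : Fin m → A) (ε : Fin m → ℂ) (j : Fin m),
      (∀ i < j, x * g i = ε i • (g i * x)) →
      x * (List.ofFn g).prod =
        (∏ i ∈ Finset.Iio j, ε i) • (List.ofFn (Function.update g j (x * g j))).prod
  | 0, _, _, j, _ => j.elim0
  | m + 1, g, ε, j, h => by
    induction j using Fin.cases with
    | zero =>
      have h0 : Finset.Iio (0 : Fin (m + 1)) = ∅ := Finset.Iio_bot
      simp [h0, List.ofFn_succ, mul_assoc]
    | succ j =>
      have ih := mul_prod_ofFn x (fun i => g i.succ) (fun i => ε i.succ) j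
        fun i hi => h i.succ (Fin.succ_lt_succ_iff.mpr hi)
      have hu : (fun i : Fin m => Function.update g j.succ (x * g j.succ) i.succ) =
          Function.update (fun i => g i.succ) j (x * g j.succ) := by
        funext i
        by_cases hij : i = j
        · subst hij; simp
        · simp [hij]
      have hI : ∏ i ∈ Finset.Iio j.succ, ε i = ε 0 * ∏ i ∈ Finset.Iio j, ε i.succ := by
        -- Indicator factors turn products over initial segments into products over all indices,
        -- where the factor at 0 splits off.
        have key : ∀ {r : ℕ} (a : Fin r → ℂ) (t : Fin r),
            ∏ i ∈ Finset.Iio t, a i = ∏ i, if i < t then a i else 1 := fun a t => by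
          rw [← Finset.prod_filter]
          exact Finset.prod_congr (by ext; simp) fun _ _ => rfl
        rw [key, key, Fin.prod_univ_succ]
        simp only [Fin.succ_pos, if_true, Fin.succ_lt_succ_iff]
      rw [List.ofFn_succ, List.ofFn_succ, List.prod_cons, List.prod_cons, hu, hI, ← mul_assoc,
        h 0 (Fin.succ_pos j), smul_mul_assoc, mul_assoc, ih, mul_smul_comm, smul_smul,
        Function.update_of_ne (Fin.succ_ne_zero j).symm]

theorem bPlus_commute_monomial (j i : Fin n) (a c : ℕ) :
    Commute (bPlus j) (bPlus i ^ a * fPlus i ^ c) :=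
  ((show Commute (bPlus j) (bPlus i) from bPlus_mul_bPlus j i).pow_right a).mul_right
    ((show Commute (bPlus j) (fPlus i) from (fPlus_mul_bPlus i j).symm).pow_right c)

theorem fPlus_mul_fPlus_pow (j i : Fin n) (c : ℕ) :
    fPlus j * fPlus i ^ c = (-1 : ℂ) ^ c • (fPlus i ^ c * fPlus j) := by
  induction c with
  | zero => simp
  | succ c ih =>
    rw [pow_succ, ← mul_assoc, ih, smul_mul_assoc, mul_assoc, fPlus_mul_fPlus j i, pow_succ,
      mul_neg, mul_smul, mul_assoc, neg_one_smul]

theorem fPlus_mul_monomial (j i : Fin n) (a c : ℕ) :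
    fPlus j * (bPlus i ^ a * fPlus i ^ c) =
      (-1 : ℂ) ^ c • (bPlus i ^ a * fPlus i ^ c * fPlus j) := by
  have h : Commute (fPlus j) (bPlus i ^ a) :=
    (show Commute (fPlus j) (bPlus i) from fPlus_mul_bPlus j i).pow_right a
  rw [← mul_assoc, h.eq, mul_assoc, fPlus_mul_fPlus_pow, mul_smul_comm, mul_assoc]

theorem bPlus_smul_ket (s : ℂ) (j : Fin n) (k l : Fin n → ℕ) :
    bPlus j • ket s k l = ket s (upd k j (k j + 1)) l := by
  rw [ket, smul_smul, mul_prod_ofFn _ _ (fun _ => 1) j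
    (fun i _ => by rw [one_smul, (bPlus_commute_monomial j i _ _).eq])]
  rw [Finset.prod_const_one, one_smul, ket]
  congr 3
  funext i
  by_cases hij : i = j
  · subst hij; simp [pow_succ', mul_assoc]
  · simp [hij]

theorem fPlus_smul_ket (s : ℂ) (j : Fin n) (k l : Fin n → ℕ) (hl : ∀ i, l i = 0 ∨ l i = 1) :
    fPlus j • ket s k l =
      (signBelow l j * (if l j = 0 then 1 else 0)) • ket s k (upd l j (l j + 1)) := by
  rw [ket, smul_smul, mul_prod_ofFn _ _ (fun i => (-1) ^ l i) j
    (fun i _ => fPlus_mul_monomial j i _ _), Finset.prod_pow_eq_pow_sum, fPlus_mul_monomial j j,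
    mul_assoc, ← pow_succ, ← signBelow]
  obtain h | h := hl j
  · rw [if_pos h, mul_one, smul_assoc, ket]
    congr 4
    funext i
    by_cases hij : i = j
    · subst hij; simp [h]
    · simp [hij]
  -- When l_j = 1 the factor at place j contains (f_j^+)² = 0.
  · rw [if_neg (by omega), mul_zero, zero_smul, List.prod_eq_zero, smul_zero, zero_smul]
    refine (List.mem_ofFn' _ _).mpr ⟨j, ?_⟩
    rw [Function.update_self, h, one_add_one_eq_two, pow_two (fPlus j), fPlus_mul_self, mul_zero, smul_zero]

theorem ket_zero (s : ℂ) : ket s (0 : Fin n → ℕ) 0 = vacuum n s := by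
  simp [ket]

/-! ### Induction on the labels. -/

/-- The induction runs on the total degree: some nonzero k_i is lowered if there is one, otherwise
some l_i = 1 is. The odd step may occur at any place, so using it costs the sign `signBelow l i`. -/
theorem label_induction_aux {Q : (Fin n → ℕ) → (Fin n → ℕ) → Prop} (zero : Q 0 0)
    (even : ∀ i k l, (∀ i, l i = 0 ∨ l i = 1) → Q k l → Q (upd k i (k i + 1)) l)
    (odd : ∀ i k l, (∀ i, l i = 0 ∨ l i = 1) → l i = 0 → Q k l → Q k (upd l i 1))
    (k l : Fin n → ℕ) (hl : ∀ i, l i = 0 ∨ l i = 1) : Q k l := by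
  have main : ∀ m : ℕ, ∀ k l : Fin n → ℕ, (∀ i, l i = 0 ∨ l i = 1) →
      ∑ i, k i + ∑ i, l i = m → Q k l := by
    have sum_lt : ∀ (a : Fin n → ℕ) (i : Fin n) (c : ℕ), a i = c + 1 →
        ∑ j, a j = ∑ j, upd a i c j + 1 := by
      intro a i c h
      rw [Finset.sum_update_of_mem (Finset.mem_univ i),
        ← Finset.add_sum_erase _ _ (Finset.mem_univ i), h, Finset.sdiff_singleton_eq_erase]
      ring
    intro m
    induction m with
    | zero =>
      intro k l _ h
      have hk : k = 0 := by
        funext i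
        have := Finset.single_le_sum (f := k) (fun _ _ => Nat.zero_le _) (Finset.mem_univ i)
        exact Nat.eq_zero_of_le_zero (by omega)
      have hl : l = 0 := by
        funext i
        have := Finset.single_le_sum (f := l) (fun _ _ => Nat.zero_le _) (Finset.mem_univ i)
        exact Nat.eq_zero_of_le_zero (by omega)
      rw [hk, hl]
      exact zero
    | succ m ih =>
      intro k l hl h
      by_cases hk : ∃ i, k i ≠ 0
      · obtain ⟨i, hi⟩ := hk
        obtain ⟨c, hc⟩ := Nat.exists_eq_succ_of_ne_zero hi
        have := sum_lt k i c hc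
        have hQ := even i _ l hl (ih (upd k i c) l hl (by omega))
        rwa [upd, upd, Function.update_self, Function.update_idem, ← Nat.succ_eq_add_one, ← hc,
          Function.update_eq_self] at hQ
      · push Not at hk
        have hk0 : ∑ i, k i = 0 := Finset.sum_eq_zero fun i _ => hk i
        obtain ⟨i, -, hi⟩ := Finset.exists_ne_zero_of_sum_ne_zero (s := Finset.univ) (f := l)
          (by omega)
        have hi1 : l i = 1 := (hl i).resolve_left hi
        have := sum_lt l i 0 hi1
        have hQ := odd i k (upd l i 0) (fun j => by
          by_cases hj : j = i
          · subst hj; simp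
          · simpa [hj] using hl j) (by simp) (ih k (upd l i 0) (fun j => by
          by_cases hj : j = i
          · subst hj; simp
          · simpa [hj] using hl j) (by omega))
        rwa [upd, upd, Function.update_idem, ← hi1, Function.update_eq_self] at hQ
  exact main _ k l hl rfl

theorem upd_zero_or_one {l : Fin n → ℕ} (hl : ∀ i, l i = 0 ∨ l i = 1) (j : Fin n) {c : ℕ}
    (hc : c = 0 ∨ c = 1) (i : Fin n) : upd l j c i = 0 ∨ upd l j c i = 1 := by
  by_cases hij : i = j
  · subst hij; simpa using hc
  · simpa [hij] using hl i

/-- Induction on the labels: every vector `|p; k, l⟩` arises from the vacuum by creation operators. -/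
theorem label_induction {Q : ∀ k l : Fin n → ℕ, (∀ i, l i = 0 ∨ l i = 1) → Prop}
    (zero : Q 0 0 fun _ => Or.inl rfl)
    (even : ∀ i k l hl, Q k l hl → Q (upd k i (k i + 1)) l hl)
    (odd : ∀ i k l hl, l i = 0 → Q k l hl →
      Q k (upd l i 1) (upd_zero_or_one hl i (Or.inr rfl)))
    (k l : Fin n → ℕ) (hl : ∀ i, l i = 0 ∨ l i = 1) : Q k l hl :=
  label_induction_aux (Q := fun k l => ∀ hl, Q k l hl) (fun _ => zero)
    (fun i k l hl h _ => even i k l hl (h hl)) (fun i k l hl h0 h _ => odd i k l hl h0 (h hl))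
    k l hl hl

/-! ### Signs, derivatives and Leibniz rules. -/

theorem signBelow_mul_self (l : Fin n → ℕ) (j : Fin n) : signBelow l j * signBelow l j = 1 := by
  rw [signBelow, ← mul_pow]; simp

theorem signUpTo_eq (l : Fin n → ℕ) (j : Fin n) :
    signUpTo l j = (-1) ^ l j * signBelow l j := by
  rw [signUpTo, signBelow, ← pow_add, ← Finset.Iio_insert, Finset.sum_insert (by simp)]

theorem signBelow_upd (l : Fin n → ℕ) (i j : Fin n) (h : l i = 0) :
    signBelow (upd l i 1) j = (if i < j then -1 else 1) * signBelow l j := by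
  rw [signBelow, signBelow]
  split_ifs with hij
  · rw [Finset.sum_update_of_mem (Finset.mem_Iio.mpr hij),
      ← Finset.add_sum_erase _ l (Finset.mem_Iio.mpr hij), h, Finset.sdiff_singleton_eq_erase,
      pow_add, pow_one, zero_add]
  · rw [Finset.sum_update_of_notMem (by simpa using hij), one_mul]

/-- The derivative of `|p; k, l⟩` in the direction of `b_j^+`. -/
def evenDeriv (s : ℂ) (j : Fin n) (k l : Fin n → ℕ) : VBar n s :=
  (k j : ℂ) • ket s (upd k j (k j - 1)) l

/-- The left derivative of `|p; k, l⟩` in the direction of `f_j^+`. -/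
def oddDeriv (s : ℂ) (j : Fin n) (k l : Fin n → ℕ) : VBar n s :=
  (signBelow l j * l j) • ket s k (upd l j (l j - 1))

/-- Since the sign squares to 1, the action of f_i^+ can be inverted; this turns the odd induction
step into an operator identity. -/
theorem ket_upd_one (s : ℂ) (i : Fin n) (k l : Fin n → ℕ) (hl : ∀ i, l i = 0 ∨ l i = 1)
    (h : l i = 0) : ket s k (upd l i 1) = signBelow l i • fPlus i • ket s k l := by
  rw [fPlus_smul_ket s i k l hl, if_pos h, mul_one, smul_smul, signBelow_mul_self, one_smul, h]

theorem evenDeriv_zero (s : ℂ) (j : Fin n) : evenDeriv s j 0 0 = 0 := by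
  simp [evenDeriv]

theorem oddDeriv_zero (s : ℂ) (j : Fin n) : oddDeriv s j 0 0 = 0 := by
  simp [oddDeriv]

/-- The first of four Leibniz rules: the even derivative at j commutes with b_i^+ up to δ_{ij}. -/
theorem evenDeriv_upd_even (s : ℂ) (i j : Fin n) (k l : Fin n → ℕ) :
    evenDeriv s j (upd k i (k i + 1)) l =
      bPlus i • evenDeriv s j k l + if i = j then ket s k l else 0 := by
  rw [evenDeriv, evenDeriv, smul_comm, bPlus_smul_ket]
  by_cases hij : i = j
  · subst hij
    rcases Nat.eq_zero_or_pos (k i) with h | h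
    · have hk : Function.update k i 0 = k := by rw [← h]; exact Function.update_eq_self i k
      simp [h, upd, hk]
    · simp [upd, Nat.sub_add_cancel h, add_smul]
  · have h1 : upd (upd k i (k i + 1)) j (k j - 1) = upd (upd k j (k j - 1)) i (k i + 1) :=
      Function.update_comm hij _ _ _
    have h2 : j ≠ i := Ne.symm hij
    simp only [upd, Function.update_of_ne h2, Function.update_of_ne hij, if_neg hij,
      add_zero] at h1 ⊢
    rw [h1]

theorem oddDeriv_upd_even (s : ℂ) (i j : Fin n) (k l : Fin n → ℕ) :
    oddDeriv s j (upd k i (k i + 1)) l = bPlus i • oddDeriv s j k l := by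
  rw [oddDeriv, oddDeriv, smul_comm, bPlus_smul_ket]

theorem evenDeriv_upd_odd (s : ℂ) (i j : Fin n) (k l : Fin n → ℕ) (hl : ∀ i, l i = 0 ∨ l i = 1)
    (h : l i = 0) :
    evenDeriv s j k (upd l i 1) = signBelow l i • fPlus i • evenDeriv s j k l := by
  rw [evenDeriv, evenDeriv, ket_upd_one s i _ l hl h, smul_comm (fPlus i), smul_comm]

/-- The odd derivative anticommutes with f_i^+ up to δ_{ij}, whence the minus sign. -/
theorem oddDeriv_upd_odd (s : ℂ) (i j : Fin n) (k l : Fin n → ℕ) (hl : ∀ i, l i = 0 ∨ l i = 1)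
    (h : l i = 0) :
    oddDeriv s j k (upd l i 1) =
      signBelow l i • ((if i = j then ket s k l else 0) - fPlus i • oddDeriv s j k l) := by
  rw [oddDeriv, oddDeriv]
  by_cases hij : i = j
  · subst hij
    have hl0 : Function.update l i 0 = l := by rw [← h]; exact Function.update_eq_self i l
    rw [signBelow_upd l i i h]
    simp [h, upd, hl0]
  · have hji : j ≠ i := Ne.symm hij
    rw [if_neg hij, zero_sub, smul_comm (fPlus i)]
    simp only [upd, Function.update_of_ne hji]
    obtain h1 | h1 := hl j
    · simp [h1]
    · have hl0 := upd_zero_or_one hl j (c := 0) (Or.inl rfl)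
      have h0 : upd l j 0 i = 0 := by simp [upd, hij, h]
      have hsign : signBelow l i = (if j < i then -1 else 1) * signBelow (upd l j 0) i := by
        rw [← signBelow_upd _ _ _ (by simp)]
        simp only [upd, Function.update_idem, ← h1, Function.update_eq_self]
      have hu := signBelow_upd l i j h
      have hk := ket_upd_one s i k _ hl0 h0
      rw [h1, Nat.sub_self, Function.update_comm hij, ← upd, ← upd, hk, hu, hsign]
      rw [← smul_neg, smul_smul, ← neg_one_smul ℂ (_ • _ : VBar n s), smul_smul, smul_smul]
      congr 1
      -- For i ≠ j exactly one of i < j and j < i holds, so changing the order of the two odd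
      -- operations costs exactly one sign.
      have : (if i < j then -1 else 1 : ℂ) = -(if j < i then -1 else 1) := by
        rcases lt_or_gt_of_ne hij with h | h
        · simp [h, h.not_gt]
        · simp [h, h.not_gt]
      rw [this]
      push_cast
      ring

/-! ### Moving generators past creation operators and past E. -/

section Relations

variable {V : Type*} [AddCommGroup V] [Module ℂ V] [Module (U n) V] [IsScalarTower ℂ (U n) V]

theorem bMinus_smul_bPlus_smul (j i : Fin n) (v : V) :
    bMinus j • bPlus i • v = bPlus i • bMinus j • v
      + (if i = j then ι n (e 0 0 0) • v else 0) - ι n (e i.succ j.succ 0) • v := by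
  simp [bMinus, bPlus, ι_e_smul_ι_e_smul 0 j.succ i.succ 0, eq_comm]

theorem bMinus_smul_fPlus_smul (j i : Fin n) (v : V) :
    bMinus j • fPlus i • v = fPlus i • bMinus j • v
      + (if i = j then ι n (e 0 0 1) • v else 0) - ι n (e i.succ j.succ 1) • v := by
  simp [bMinus, fPlus, ι_e_smul_ι_e_smul 0 j.succ i.succ 0, eq_comm]

theorem fMinus_smul_bPlus_smul (j i : Fin n) (v : V) :
    fMinus j • bPlus i • v = bPlus i • fMinus j • v
      + (if i = j then ι n (e 0 0 1) • v else 0) - ι n (e i.succ j.succ 1) • v := by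
  simp [fMinus, bPlus, ι_e_smul_ι_e_smul 0 j.succ i.succ 0, eq_comm]

theorem fMinus_smul_fPlus_smul (j i : Fin n) (v : V) :
    fMinus j • fPlus i • v = -(fPlus i • fMinus j • v)
      + (if i = j then ι n (e 0 0 0) • v else 0) + ι n (e i.succ j.succ 0) • v := by
  have h : (1 + 1 : ZMod 2) = 0 := rfl
  simp [fMinus, fPlus, ι_e_smul_ι_e_smul 0 j.succ i.succ 0, ZMod.val_one, h, eq_comm]

theorem e_even_smul_bPlus_smul (i j m : Fin n) (v : V) :
    ι n (e i.succ j.succ 0) • bPlus m • v = bPlus m • ι n (e i.succ j.succ 0) • v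
      + if m = j then bPlus i • v else 0 := by
  simp [bPlus, ι_e_smul_ι_e_smul i.succ j.succ m.succ 0, (Fin.succ_ne_zero _).symm,
    eq_comm (a := j)]

theorem e_even_smul_fPlus_smul (i j m : Fin n) (v : V) :
    ι n (e i.succ j.succ 0) • fPlus m • v = fPlus m • ι n (e i.succ j.succ 0) • v
      + if m = j then fPlus i • v else 0 := by
  simp [fPlus, ι_e_smul_ι_e_smul i.succ j.succ m.succ 0, (Fin.succ_ne_zero _).symm,
    eq_comm (a := j)]

theorem e_odd_smul_bPlus_smul (i j m : Fin n) (v : V) :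
    ι n (e i.succ j.succ 1) • bPlus m • v = bPlus m • ι n (e i.succ j.succ 1) • v
      + if m = j then fPlus i • v else 0 := by
  simp [bPlus, fPlus, ι_e_smul_ι_e_smul i.succ j.succ m.succ 0, (Fin.succ_ne_zero _).symm,
    eq_comm (a := j)]

theorem e_odd_smul_fPlus_smul (i j m : Fin n) (v : V) :
    ι n (e i.succ j.succ 1) • fPlus m • v = -(fPlus m • ι n (e i.succ j.succ 1) • v)
      + if m = j then bPlus i • v else 0 := by
  have h : (1 + 1 : ZMod 2) = 0 := rfl
  simp [bPlus, fPlus, ι_e_smul_ι_e_smul i.succ j.succ m.succ 0, (Fin.succ_ne_zero _).symm,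
    ZMod.val_one, h, eq_comm (a := j)]

theorem e_zero_even_smul_bPlus_smul (m : Fin n) (v : V) :
    ι n (e 0 0 0) • bPlus m • v = bPlus m • ι n (e 0 0 0) • v - bPlus m • v := by
  simp [bPlus, ι_e_smul_ι_e_smul 0 0 m.succ 0, (Fin.succ_ne_zero _).symm]

theorem e_zero_even_smul_fPlus_smul (m : Fin n) (v : V) :
    ι n (e 0 0 0) • fPlus m • v = fPlus m • ι n (e 0 0 0) • v - fPlus m • v := by
  simp [fPlus, ι_e_smul_ι_e_smul 0 0 m.succ 0, (Fin.succ_ne_zero _).symm]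

theorem e_zero_odd_smul_bPlus_smul (m : Fin n) (v : V) :
    ι n (e 0 0 1) • bPlus m • v = bPlus m • ι n (e 0 0 1) • v - fPlus m • v := by
  simp [bPlus, fPlus, ι_e_smul_ι_e_smul 0 0 m.succ 0, (Fin.succ_ne_zero _).symm]

theorem e_zero_odd_smul_fPlus_smul (m : Fin n) (v : V) :
    ι n (e 0 0 1) • fPlus m • v = -(fPlus m • ι n (e 0 0 1) • v) + bPlus m • v := by
  have h : (1 + 1 : ZMod 2) = 0 := rfl
  simp [bPlus, fPlus, ι_e_smul_ι_e_smul 0 0 m.succ 0, (Fin.succ_ne_zero _).symm,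
    ZMod.val_one, h]

/-- The superbracket of the odd element with itself is 2 e_{00}^0, and 2 is cancelled. -/
theorem e_zero_odd_smul_self_smul (v : V) :
    ι n (e 0 0 1) • ι n (e 0 0 1) • v = ι n (e 0 0 0) • v := by
  have h : (1 + 1 : ZMod 2) = 0 := rfl
  have h2 := ι_e_smul_ι_e_smul (n := n) 0 0 0 0 1 1 v
  simp only [ZMod.val_one, h, if_true, mul_one, pow_one, neg_one_smul, sub_neg_eq_add] at h2
  have h3 : (2 : ℂ) • (ι n (e 0 0 1) • ι n (e 0 0 1) • v) = (2 : ℂ) • (ι n (e 0 0 0) • v) := by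
    rw [two_smul, two_smul]
    nth_rewrite 1 [h2]
    abel
  exact smul_right_injective V two_ne_zero h3

theorem bMinus_smul_e_zero_odd_smul (j : Fin n) (v : V) :
    bMinus j • ι n (e 0 0 1) • v = ι n (e 0 0 1) • bMinus j • v - fMinus j • v := by
  simp [bMinus, fMinus, ι_e_smul_ι_e_smul 0 j.succ 0 0]

theorem fMinus_smul_e_zero_odd_smul (j : Fin n) (v : V) :
    fMinus j • ι n (e 0 0 1) • v = -(ι n (e 0 0 1) • fMinus j • v) + bMinus j • v := by
  have h : (1 + 1 : ZMod 2) = 0 := rfl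
  simp [bMinus, fMinus, ι_e_smul_ι_e_smul 0 j.succ 0 0, ZMod.val_one, h]

end Relations

/-! ### The even part and q(n) acting as differential operators. -/

/-- The level `∑ (k_i + l_i)` of the vector `|p; k, l⟩`. -/
def level (k l : Fin n → ℕ) : ℂ := ∑ i, ((k i : ℂ) + l i)

theorem level_zero : level (0 : Fin n → ℕ) 0 = 0 := by simp [level]

theorem sum_cast_upd (a : Fin n → ℕ) (i : Fin n) (c : ℕ) :
    ∑ j, (upd a i c j : ℂ) = ∑ j, (a j : ℂ) + c - a i := by
  have h := Finset.sum_update_of_mem (Finset.mem_univ i) (fun j => (a j : ℂ)) (c : ℂ)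
  rw [← Finset.add_sum_erase _ (fun j => (a j : ℂ)) (Finset.mem_univ i),
    ← Finset.add_sum_erase _ _ (Finset.mem_univ i)]
  rw [Finset.sum_congr rfl (g := fun j => (a j : ℂ)) fun j hj => by
    rw [upd, Function.update_of_ne (Finset.ne_of_mem_erase hj)]]
  rw [upd, Function.update_self]
  ring

theorem level_upd_even (k l : Fin n → ℕ) (i : Fin n) (c : ℕ) :
    level (upd k i c) l = level k l + c - k i := by
  rw [level, level, Finset.sum_add_distrib, Finset.sum_add_distrib, sum_cast_upd]
  ring

theorem level_upd_odd (k l : Fin n → ℕ) (i : Fin n) (c : ℕ) :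
    level k (upd l i c) = level k l + c - l i := by
  rw [level, level, Finset.sum_add_distrib, Finset.sum_add_distrib, sum_cast_upd]
  ring

/-- This generator kills the vacuum and its brackets replace b_j^+ by b_i^+ and f_j^+ by f_i^+, so
it acts as an even derivation. -/
theorem e_even_smul_ket (s : ℂ) (i j : Fin n) (k l : Fin n → ℕ) (hl : ∀ i, l i = 0 ∨ l i = 1) :
    ι n (e i.succ j.succ 0) • ket s k l =
      bPlus i • evenDeriv s j k l + fPlus i • oddDeriv s j k l := by
  induction k, l, hl using label_induction with
  | zero =>
    rw [ket_zero, e_succ_succ_smul_vacuum, evenDeriv_zero, oddDeriv_zero, smul_zero, smul_zero,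
      add_zero]
  | even m k l hl ih =>
    rw [← bPlus_smul_ket, e_even_smul_bPlus_smul, ih, evenDeriv_upd_even, oddDeriv_upd_even]
    simp only [smul_add, smul_ite, smul_zero, smul_smul, bPlus_mul_bPlus m i, fPlus_mul_bPlus i m]
    split_ifs <;> abel
  | odd m k l hl h ih =>
    rw [ket_upd_one s m k l hl h, smul_comm, e_even_smul_fPlus_smul, ih,
      evenDeriv_upd_odd s m j k l hl h, oddDeriv_upd_odd s m j k l hl h, smul_comm (bPlus i),
      smul_comm (fPlus i), ← smul_add]
    congr 1
    simp only [smul_add, smul_sub, smul_ite, smul_zero, smul_smul, fPlus_mul_bPlus m i, fPlus_mul_fPlus m i, neg_smul]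
    split_ifs <;> abel

theorem e_odd_smul_ket (s : ℂ) (i j : Fin n) (k l : Fin n → ℕ) (hl : ∀ i, l i = 0 ∨ l i = 1) :
    ι n (e i.succ j.succ 1) • ket s k l =
      fPlus i • evenDeriv s j k l + bPlus i • oddDeriv s j k l := by
  induction k, l, hl using label_induction with
  | zero =>
    rw [ket_zero, e_succ_succ_smul_vacuum, evenDeriv_zero, oddDeriv_zero, smul_zero, smul_zero,
      add_zero]
  | even m k l hl ih =>
    rw [← bPlus_smul_ket, e_odd_smul_bPlus_smul, ih, evenDeriv_upd_even, oddDeriv_upd_even]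
    simp only [smul_add, smul_ite, smul_zero, smul_smul, bPlus_mul_bPlus m i, fPlus_mul_bPlus i m]
    split_ifs <;> abel
  | odd m k l hl h ih =>
    rw [ket_upd_one s m k l hl h, smul_comm, e_odd_smul_fPlus_smul, ih,
      evenDeriv_upd_odd s m j k l hl h, oddDeriv_upd_odd s m j k l hl h, smul_comm (bPlus i),
      smul_comm (fPlus i), ← smul_add]
    congr 1
    simp only [smul_add, smul_sub, smul_ite, smul_zero, smul_smul, fPlus_mul_bPlus m i, fPlus_mul_fPlus m i, neg_smul]
    split_ifs <;> abel

theorem e_zero_even_smul_ket (s : ℂ) (k l : Fin n → ℕ) (hl : ∀ i, l i = 0 ∨ l i = 1) :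
    ι n (e 0 0 0) • ket s k l = (s ^ 2 - level k l) • ket s k l := by
  induction k, l, hl using label_induction with
  | zero => rw [ket_zero, e_zero_zero_even_smul_vacuum, level_zero, sub_zero]
  | even m k l hl ih =>
    rw [← bPlus_smul_ket, e_zero_even_smul_bPlus_smul, ih, level_upd_even, smul_comm]
    push_cast
    generalize bPlus m • ket s k l = x
    module
  | odd m k l hl h ih =>
    rw [ket_upd_one s m k l hl h, smul_comm, e_zero_even_smul_fPlus_smul, ih, level_upd_odd,
      smul_comm (fPlus m), h]
    push_cast
    generalize fPlus m • ket s k l = x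
    module

/-- The superbrackets of E send f_i^+ to b_i^+ and b_i^+ to -f_i^+. The first term is E reaching the
vacuum after passing all odd factors. -/
theorem e_zero_odd_smul_ket (s : ℂ) (k l : Fin n → ℕ) (hl : ∀ i, l i = 0 ∨ l i = 1) :
    ι n (e 0 0 1) • ket s k l =
      ((-1 : ℂ) ^ (∑ i, l i) * s) • ket s k l + ∑ i, bPlus i • oddDeriv s i k l
        - ∑ i, fPlus i • evenDeriv s i k l := by
  induction k, l, hl using label_induction with
  | zero =>
    simp [ket_zero, e_zero_zero_odd_smul_vacuum, evenDeriv_zero, oddDeriv_zero]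
  | even m k l hl ih =>
    rw [← bPlus_smul_ket, e_zero_odd_smul_bPlus_smul, ih]
    simp only [evenDeriv_upd_even, oddDeriv_upd_even, smul_add, smul_sub, Finset.smul_sum,
      smul_ite, smul_zero, Finset.sum_add_distrib, Finset.sum_ite_eq, Finset.mem_univ, if_true,
      smul_comm (bPlus m) (_ : ℂ)]
    simp only [smul_smul, fPlus_mul_bPlus _ m, bPlus_mul_bPlus _ m]
    abel
  | odd m k l hl h ih =>
    have hs : (-1 : ℂ) ^ (∑ i, upd l m 1 i) = -(-1) ^ (∑ i, l i) := by
      rw [Finset.sum_update_of_mem (Finset.mem_univ m),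
        ← Finset.add_sum_erase _ l (Finset.mem_univ m), h, Finset.sdiff_singleton_eq_erase,
        pow_add, pow_one, zero_add, neg_one_mul]
    rw [hs, ket_upd_one s m k l hl h, smul_comm, e_zero_odd_smul_fPlus_smul, ih]
    simp only [evenDeriv_upd_odd s m _ k l hl h, oddDeriv_upd_odd s m _ k l hl h,
      smul_comm (fPlus _) (signBelow l m), smul_comm (bPlus _) (signBelow l m),
      smul_comm _ (signBelow l m) (fPlus _ • ket s k l)]
    rw [← Finset.smul_sum, ← Finset.smul_sum, ← smul_add, ← smul_sub]
    congr 1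
    simp only [smul_add, smul_sub, Finset.smul_sum, smul_ite, smul_zero, Finset.sum_sub_distrib,
      Finset.sum_ite_eq, Finset.mem_univ, if_true, smul_comm (fPlus m) (_ : ℂ)]
    simp only [smul_smul, fPlus_mul_bPlus m, fPlus_mul_fPlus m, neg_smul, neg_mul,
      Finset.sum_neg_distrib]
    abel

/-! ### X as an image under E, and the annihilation operators. -/

theorem X_eq (s : ℂ) (k l : Fin n → ℕ) (hl : ∀ i, l i = 0 ∨ l i = 1) :
    X s k l = ι n (e 0 0 1) • ket s k l := by
  have h1 : ∑ i, bPlus i • oddDeriv s i k l =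
      -∑ i, (signUpTo l i * l i) • ket s (upd k i (k i + 1)) (upd l i (l i - 1)) := by
    rw [← Finset.sum_neg_distrib]
    refine Finset.sum_congr rfl fun i _ => ?_
    rw [oddDeriv, smul_comm, bPlus_smul_ket, signUpTo_eq, ← neg_smul]
    obtain h | h := hl i <;> simp [h]
  have h2 : ∑ i, fPlus i • evenDeriv s i k l =
      ∑ i, (signUpTo l i * (if l i = 0 then 1 else 0) * k i) •
        ket s (upd k i (k i - 1)) (upd l i (l i + 1)) := by
    refine Finset.sum_congr rfl fun i _ => ?_
    rw [evenDeriv, smul_comm, fPlus_smul_ket s i _ l hl, signUpTo_eq, smul_smul]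
    obtain h | h := hl i <;> simp [h, mul_comm]
  rw [e_zero_odd_smul_ket s k l hl, X, h1, h2, sub_eq_add_neg (_ • ket s k l)]

/-- Each creation operator passed leaves a diagonal term in e_{00}^σ and a q(n) term, both already
known. They account for the drop of the coefficient by one and for moving E past the new operator.
-/
theorem annihilation_smul_ket (s : ℂ) (j : Fin n) (k l : Fin n → ℕ)
    (hl : ∀ i, l i = 0 ∨ l i = 1) :
    bMinus j • ket s k l = (s ^ 2 + 1 - level k l) • evenDeriv s j k l
        + ι n (e 0 0 1) • oddDeriv s j k l ∧
      fMinus j • ket s k l = (s ^ 2 + 1 - level k l) • oddDeriv s j k l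
        + ι n (e 0 0 1) • evenDeriv s j k l := by
  induction k, l, hl using label_induction with
  | zero =>
    rw [ket_zero, bMinus, fMinus, e_zero_succ_smul_vacuum, e_zero_succ_smul_vacuum,
      evenDeriv_zero, oddDeriv_zero]
    simp
  | even m k l hl ih =>
    rw [← bPlus_smul_ket, bMinus_smul_bPlus_smul, fMinus_smul_bPlus_smul, ih.1, ih.2,
      evenDeriv_upd_even, oddDeriv_upd_even, e_zero_odd_smul_bPlus_smul, level_upd_even,
      e_even_smul_ket s m j k l hl, e_odd_smul_ket s m j k l hl, e_zero_even_smul_ket s k l hl]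
    simp only [smul_add, smul_ite, smul_zero, smul_comm (bPlus m) (_ : ℂ), e_zero_odd_smul_bPlus_smul]
    push_cast
    -- With the vectors abstracted, only linear identities with scalar coefficients remain.
    generalize bPlus m • evenDeriv s j k l = v₁, fPlus m • evenDeriv s j k l = v₂,
      bPlus m • oddDeriv s j k l = v₃, fPlus m • oddDeriv s j k l = v₄,
      bPlus m • ι n (e 0 0 1) • evenDeriv s j k l = v₅,
      bPlus m • ι n (e 0 0 1) • oddDeriv s j k l = v₆,
      ι n (e 0 0 1) • ket s k l = v₇
    constructor <;> split_ifs <;> module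
  | odd m k l hl h ih =>
    rw [ket_upd_one s m k l hl h, smul_comm (bMinus j), smul_comm (fMinus j),
      bMinus_smul_fPlus_smul, fMinus_smul_fPlus_smul, ih.1, ih.2,
      evenDeriv_upd_odd s m j k l hl h, oddDeriv_upd_odd s m j k l hl h, level_upd_odd, h,
      e_even_smul_ket s m j k l hl, e_odd_smul_ket s m j k l hl, e_zero_even_smul_ket s k l hl]
    simp only [smul_comm (ι n _) (signBelow l m), smul_comm _ (signBelow l m) (fPlus _ • _),
      smul_comm _ (signBelow l m) (_ - _), ← smul_add]
    simp only [smul_add, smul_sub, smul_ite, smul_zero, smul_comm (fPlus m) (_ : ℂ), e_zero_odd_smul_fPlus_smul]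
    push_cast
    generalize bPlus m • evenDeriv s j k l = v₁, fPlus m • evenDeriv s j k l = v₂,
      bPlus m • oddDeriv s j k l = v₃, fPlus m • oddDeriv s j k l = v₄,
      fPlus m • ι n (e 0 0 1) • evenDeriv s j k l = v₅,
      fPlus m • ι n (e 0 0 1) • oddDeriv s j k l = v₆,
      ι n (e 0 0 1) • ket s k l = v₇
    constructor <;> split_ifs <;> module

theorem e_zero_even_smul_evenDeriv (s : ℂ) (j : Fin n) (k l : Fin n → ℕ)
    (hl : ∀ i, l i = 0 ∨ l i = 1) :
    ι n (e 0 0 0) • evenDeriv s j k l = (s ^ 2 + 1 - level k l) • evenDeriv s j k l := by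
  rw [evenDeriv, smul_comm, e_zero_even_smul_ket s _ l hl, level_upd_even, smul_comm]
  -- At k_j = 0 the subtraction truncates, but the derivative vanishes there.
  rcases Nat.eq_zero_or_pos (k j) with h | h
  · simp [h]
  · rw [Nat.cast_sub h]
    push_cast
    module

theorem e_zero_even_smul_oddDeriv (s : ℂ) (j : Fin n) (k l : Fin n → ℕ)
    (hl : ∀ i, l i = 0 ∨ l i = 1) :
    ι n (e 0 0 0) • oddDeriv s j k l = (s ^ 2 + 1 - level k l) • oddDeriv s j k l := by
  rw [oddDeriv]
  obtain h | h := hl j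
  · simp [h]
  · rw [smul_comm, e_zero_even_smul_ket s k _ (upd_zero_or_one hl j (by omega)), level_upd_odd, h]
    push_cast
    module

/-- In E(cD + E O) - (cO + E D) the O terms cancel because E² O = cO, leaving (c - 1) E D. -/
theorem bMinus_smul_e_zero_odd_smul_ket (s : ℂ) (j : Fin n) (k l : Fin n → ℕ)
    (hl : ∀ i, l i = 0 ∨ l i = 1) :
    bMinus j • ι n (e 0 0 1) • ket s k l =
      (s ^ 2 - level k l) • ι n (e 0 0 1) • evenDeriv s j k l := by
  obtain ⟨h1, h2⟩ := annihilation_smul_ket s j k l hl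
  rw [bMinus_smul_e_zero_odd_smul, h1, h2, smul_add, e_zero_odd_smul_self_smul,
    e_zero_even_smul_oddDeriv s j k l hl, smul_comm]
  generalize ι n (e 0 0 1) • evenDeriv s j k l = x
  module

theorem fMinus_smul_e_zero_odd_smul_ket (s : ℂ) (j : Fin n) (k l : Fin n → ℕ)
    (hl : ∀ i, l i = 0 ∨ l i = 1) :
    fMinus j • ι n (e 0 0 1) • ket s k l =
      (-(s ^ 2 - level k l)) • ι n (e 0 0 1) • oddDeriv s j k l := by
  obtain ⟨h1, h2⟩ := annihilation_smul_ket s j k l hl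
  rw [fMinus_smul_e_zero_odd_smul, h1, h2, smul_add, e_zero_odd_smul_self_smul,
    e_zero_even_smul_evenDeriv s j k l hl, smul_comm (ι n (e 0 0 1))]
  generalize ι n (e 0 0 1) • oddDeriv s j k l = x
  module

theorem e_zero_odd_smul_oddDeriv (s : ℂ) (j : Fin n) (k l : Fin n → ℕ)
    (hl : ∀ i, l i = 0 ∨ l i = 1) :
    ι n (e 0 0 1) • oddDeriv s j k l =
      (signBelow l j * l j) • X s k (upd l j (l j - 1)) := by
  rw [X_eq s k _ (upd_zero_or_one hl j (by have := hl j; omega)), oddDeriv, smul_comm]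

theorem e_zero_odd_smul_evenDeriv (s : ℂ) (j : Fin n) (k l : Fin n → ℕ)
    (hl : ∀ i, l i = 0 ∨ l i = 1) :
    ι n (e 0 0 1) • evenDeriv s j k l = (k j : ℂ) • X s (upd k j (k j - 1)) l := by
  rw [X_eq s _ l hl, evenDeriv, smul_comm]

end

end QFock

theorem proposition2 (n : ℕ) (p s : ℂ) (hs : s ^ 2 = p) (k l : Fin n → ℕ)
    (hl : ∀ i, l i = 0 ∨ l i = 1) :
    (∀ j : Fin n,
      -- the creation operators on `|p; k, l⟩`
      QFock.bPlus j • QFock.ket s k l = QFock.ket s (QFock.upd k j (k j + 1)) l ∧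
      QFock.fPlus j • QFock.ket s k l =
        (QFock.signBelow l j * (if l j = 0 then 1 else 0)) •
          QFock.ket s k (QFock.upd l j (l j + 1)) ∧
      -- the annihilation operators on `|p; k, l⟩`
      QFock.bMinus j • QFock.ket s k l =
        ((k j : ℂ) * (p + 1 - ∑ i, ((k i : ℂ) + l i))) •
            QFock.ket s (QFock.upd k j (k j - 1)) l
          + (QFock.signBelow l j * l j) • QFock.X s k (QFock.upd l j (l j - 1)) ∧
      QFock.fMinus j • QFock.ket s k l =
        (QFock.signBelow l j * l j * (p + 1 - ∑ i, ((k i : ℂ) + l i))) •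
            QFock.ket s k (QFock.upd l j (l j - 1))
          + (k j : ℂ) • QFock.X s (QFock.upd k j (k j - 1)) l ∧
      -- the creation operators on `X(p; k, l)`
      QFock.bPlus j • QFock.X s k l =
        QFock.X s (QFock.upd k j (k j + 1)) l
          + (QFock.signUpTo l j * (if l j = 0 then 1 else 0)) •
              QFock.ket s k (QFock.upd l j (l j + 1)) ∧
      QFock.fPlus j • QFock.X s k l =
        (-((if l j = 0 then 1 else 0) * QFock.signBelow l j)) •
            QFock.X s k (QFock.upd l j (l j + 1))
          + QFock.ket s (QFock.upd k j (k j + 1)) l ∧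
      -- the annihilation operators on `X(p; k, l)`
      QFock.bMinus j • QFock.X s k l =
        ((k j : ℂ) * (p - ∑ i, ((k i : ℂ) + l i))) •
          QFock.X s (QFock.upd k j (k j - 1)) l ∧
      QFock.fMinus j • QFock.X s k l =
        (QFock.signUpTo l j * l j * (p - ∑ i, ((k i : ℂ) + l i))) •
          QFock.X s k (QFock.upd l j (l j - 1))) ∧
    -- the vectors `X(p; k, l)` of level `p` are annihilated by all annihilation operators
    (∑ i, ((k i : ℂ) + l i) = p → ∀ x ∈ QFock.P n, QFock.ι n x • QFock.X s k l = 0) := by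
  open QFock in
  subst hs
  have hX : ∀ j, bMinus j • X s k l =
        ((k j : ℂ) * (s ^ 2 - ∑ i, ((k i : ℂ) + l i))) • X s (upd k j (k j - 1)) l := fun j => by
    rw [X_eq s k l hl, bMinus_smul_e_zero_odd_smul_ket s j k l hl,
      e_zero_odd_smul_evenDeriv s j k l hl, smul_smul, mul_comm, level]
  have hX' : ∀ j, fMinus j • X s k l =
        (signUpTo l j * l j * (s ^ 2 - ∑ i, ((k i : ℂ) + l i))) •
          X s k (upd l j (l j - 1)) := fun j => by
    rw [X_eq s k l hl, fMinus_smul_e_zero_odd_smul_ket s j k l hl,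
      e_zero_odd_smul_oddDeriv s j k l hl, smul_smul, level, signUpTo_eq]
    obtain h | h := hl j
    · simp [h]
    · rw [h]
      congr 1
      ring
  refine ⟨fun j => ⟨bPlus_smul_ket s j k l, fPlus_smul_ket s j k l hl, ?_, ?_, ?_, ?_, hX j,
    hX' j⟩, fun h x hx => ?_⟩
  · rw [(annihilation_smul_ket s j k l hl).1, e_zero_odd_smul_oddDeriv s j k l hl, evenDeriv,
      smul_smul, mul_comm, level]
  · rw [(annihilation_smul_ket s j k l hl).2, e_zero_odd_smul_evenDeriv s j k l hl, oddDeriv,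
      smul_smul, mul_comm, level]
  · have hc := e_zero_odd_smul_bPlus_smul j (ket s k l)
    rw [X_eq s k l hl, X_eq s _ l hl, ← bPlus_smul_ket, hc, fPlus_smul_ket s j k l hl,
      signUpTo_eq]
    obtain h | h := hl j <;> simp [h]
  · rw [X_eq s k l hl, ← bPlus_smul_ket]
    -- The anticommutator of E and f_j^+ is b_j^+; solving for f_j^+ X gives the formula, and for
    -- l_j = 1 the left side is 0.
    have hc := e_zero_odd_smul_fPlus_smul j (ket s k l)
    rw [fPlus_smul_ket s j k l hl] at hc
    obtain h | h := hl j
    · rw [X_eq s k _ (upd_zero_or_one hl j (by omega))]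
      simp only [h, if_true, mul_one, one_mul, smul_comm (ι n _) (_ : ℂ)] at hc ⊢
      rw [neg_smul, hc]
      abel
    · simp only [h, one_ne_zero, if_false, mul_zero, zero_mul, zero_smul, smul_zero, neg_zero,
        zero_add] at hc ⊢
      rw [eq_comm, neg_add_eq_zero] at hc
      exact hc
  · induction hx using Submodule.span_induction with
    | mem x hx =>
      obtain ⟨j, σ, rfl⟩ := hx
      have h2 : ∀ τ : ZMod 2, τ = 0 ∨ τ = 1 := by decide
      obtain rfl | rfl := h2 σ
      · rw [← bMinus, hX, h, sub_self, mul_zero, zero_smul]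
      · rw [← fMinus, hX', h, sub_self, mul_zero, zero_smul]
    | zero => rw [map_zero, zero_smul]
    | add x y _ _ hx hy => rw [map_add, add_smul, hx, hy, add_zero]
    | smul a x _ hx => rw [map_smul, smul_assoc, hx, smul_zero]
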